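/- Let $N\ge 0$ and let $w,\tilde w$ be symmetric $N\times N$ matrices with non-negative real entries and zero diagonal. For such a matrix $u$ let $\mathcal G^{u}$ be the complete weighted graph on $\{1,\dots,N\}$ with edge weights $u_{ij}$. For a finite weighted graph $\mathcal G$ with weights $m_{xy}\in\mathbb R\cup\{+\infty\}$ let $\mathrm{VR}_\alpha(\mathcal G)$, $\alpha\in\mathbb R$, be the simplicial complex of all nonempty vertex sets $\sigma$ with $m_{xy}\le\alpha$ for all $x,y\in\sigma$ (with $m_{xx}=0$), and let $l_k(\mathrm{VR}(\mathcal G))$ be the sum of the lengths of the bars of finite length, counted with multiplicity, in the $k$-th persistence barcode (homology over $\mathbb Z/2$) of the filtration $\alpha\mapsto\mathrm{VR}_\alpha(\mathcal G)$. Let $\hat{\mathcal G}^{w,\tilde w}$ be the weighted graph on two copies of $\{1,\dots,N\}$ and one additional vertex, with weight matrix $$m=\begin{pmatrix} w & (w_+)^{\top} & 0\\ w_+ & \min(w,\tilde w) & +\infty\\ 0 & +\infty & 0\end{pmatrix},$$ where $w_+$ is the matrix $w$ with the entries strictly below the diagonal replaced by $+\infty$ and $\min(w,\tilde w)$ is the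 entrywise minimum. Put $\mathrm{RTD}_k(w,\tilde w)=l_k(\mathrm{VR}(\hat{\mathcal G}^{w,\tilde w}))$. Then $$\sum_{k\ge0}(-1)^k\,\mathrm{RTD}_k(w,\tilde w)+\sum_{k\ge0}(-1)^k\, l_k(\mathrm{VR}(\mathcal G^{w}))-\sum_{k\ge0}(-1)^k\, l_k(\mathrm{VR}(\mathcal G^{\min(w,\tilde w)}))=0 ,$$ where all sums have only finitely many nonzero terms. -/

import Mathlib

namespace RTD

/-! ### Filtered simplicial complexes and their homology modulo 2 -/

/-- The Vietoris–Rips complex at threshold `α` of the complete graph on `V` whose edges have the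
(possibly infinite) weights `m`: its simplices are the nonempty finite sets of vertices all of whose
pairwise weights are at most `α`. -/
def vietorisRips {V : Type*} (m : V → V → EReal) (α : ℝ) : PreAbstractSimplicialComplex V where
  faces := {σ | σ.Nonempty ∧ ∀ x ∈ σ, ∀ y ∈ σ, m x y ≤ (α : EReal)}
  isRelLowerSet_faces := by
    rintro σ ⟨hσ, h⟩
    exact ⟨hσ, fun τ hτσ hτ => ⟨hτ, fun x hx y hy => h x (hτσ hx) y (hτσ hy)⟩⟩

/-- The Vietoris–Rips filtration of a weighted graph. -/
def vietorisRipsFiltration {V : Type*} (m : V → V → EReal) :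
    ℝ →o PreAbstractSimplicialComplex V where
  toFun := vietorisRips m
  monotone' := fun _ _ hab _ hσ =>
    ⟨hσ.1, fun x hx y hy => (hσ.2 x hx y hy).trans (EReal.coe_le_coe_iff.2 hab)⟩

/-- The space `C_k(K)` of `k`-dimensional simplicial chains modulo 2. A formal sum of finite sets of
vertices is given by its coefficients; those of a chain vanish outside the `k`-simplices of `K`. -/
def chains {V : Type*} (K : PreAbstractSimplicialComplex V) (k : ℕ) :
    Submodule (ZMod 2) (Finset V → ZMod 2) where
  carrier := {c | ∀ σ, c σ ≠ 0 → σ ∈ K ∧ σ.card = k + 1}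
  zero_mem' := fun _ h => absurd rfl h
  add_mem' := by
    intro c c' hc hc' σ h
    by_cases h0 : c σ = 0
    · exact hc' σ fun h1 => h (by simp [h0, h1])
    · exact hc σ h0
  smul_mem' := fun r c hc σ h => hc σ fun h0 => h (by simp [h0])

/-- The boundary operator `∂_k`, which sends a simplex to the sum of its facets; `∂_0 = 0`. -/
noncomputable def boundary {V : Type*} [Fintype V] [DecidableEq V] :
    ℕ → (Finset V → ZMod 2) →ₗ[ZMod 2] (Finset V → ZMod 2)
  | 0 => 0
  | _ + 1 => Fintype.linearCombination (ZMod 2)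
      fun σ : Finset V => ∑ v ∈ σ, Pi.single (σ.erase v) (1 : ZMod 2)

/-- The `k`-cycles of `K`. -/
noncomputable def cycles {V : Type*} [Fintype V] [DecidableEq V] (K : PreAbstractSimplicialComplex V) (k : ℕ) :
    Submodule (ZMod 2) (Finset V → ZMod 2) :=
  chains K k ⊓ LinearMap.ker (boundary k)

/-- The `k`-boundaries of `K`. -/
noncomputable def boundaries {V : Type*} [Fintype V] [DecidableEq V]
    (K : PreAbstractSimplicialComplex V) (k : ℕ) : Submodule (ZMod 2) (Finset V → ZMod 2) :=
  (chains K (k + 1)).map (boundary (k + 1))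

theorem chains_mono {V : Type*} {K L : PreAbstractSimplicialComplex V} (h : K ≤ L) (k : ℕ) :
    chains K k ≤ chains L k :=
  fun _ hc σ hσ => ⟨h (hc σ hσ).1, (hc σ hσ).2⟩

theorem cycles_mono {V : Type*} [Fintype V] [DecidableEq V] {K L : PreAbstractSimplicialComplex V}
    (h : K ≤ L) (k : ℕ) : cycles K k ≤ cycles L k :=
  inf_le_inf_right _ (chains_mono h k)

theorem boundaries_mono {V : Type*} [Fintype V] [DecidableEq V] {K L : PreAbstractSimplicialComplex V}
    (h : K ≤ L) (k : ℕ) : boundaries K k ≤ boundaries L k :=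
  Submodule.map_mono (chains_mono h (k + 1))

theorem boundary_succ_single {V : Type*} [Fintype V] [DecidableEq V] (k : ℕ) (σ : Finset V) :
    boundary (k + 1) (Pi.single σ (1 : ZMod 2)) =
      ∑ v ∈ σ, Pi.single (σ.erase v) (1 : ZMod 2) := by
  simp [boundary]

theorem boundary_boundary_single {V : Type*} [Fintype V] [DecidableEq V] (k : ℕ) (σ : Finset V) :
    boundary k (boundary (k + 1) (Pi.single σ (1 : ZMod 2))) = 0 := by
  cases k with
  | zero => simp [boundary]
  | succ k =>
    rw [boundary_succ_single, map_sum]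
    simp only [boundary_succ_single]
    rw [Finset.sum_sigma']
    refine Finset.sum_involution (fun p _ => ⟨p.2, p.1⟩) ?_ ?_ ?_ ?_
    · rintro ⟨a, b⟩ _
      simp only [Finset.erase_right_comm (a := a) (b := b)]
      rw [← Pi.single_add]
      have h2 : (1 : ZMod 2) + 1 = 0 := by decide
      rw [h2, Pi.single_zero]
    · rintro ⟨a, b⟩ h _ heq
      simp only [Finset.mem_sigma, Finset.mem_erase] at h
      simp only [Sigma.mk.injEq] at heq
      exact h.2.1 heq.1
    · rintro ⟨a, b⟩ h
      simp only [Finset.mem_sigma, Finset.mem_erase] at h ⊢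
      exact ⟨h.2.2, Ne.symm h.2.1, h.1⟩
    · rintro ⟨a, b⟩ _
      rfl

/-- Boundaries are cycles. -/
theorem boundaries_le_cycles {V : Type*} [Fintype V] [DecidableEq V] (K : PreAbstractSimplicialComplex V)
    (k : ℕ) : boundaries K k ≤ cycles K k := by
  rintro _ ⟨c, hc, rfl⟩
  have hsum : c = ∑ σ, c σ • (Pi.single σ (1 : ZMod 2) : Finset V → ZMod 2) := by
    simpa using (pi_eq_sum_univ' c)
  rw [hsum, map_sum]
  refine Submodule.sum_mem _ fun σ _ => ?_
  rw [map_smul]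
  by_cases h0 : c σ = 0
  · rw [h0, zero_smul]
    exact Submodule.zero_mem _
  refine Submodule.smul_mem _ _ ⟨?_, LinearMap.mem_ker.2 (boundary_boundary_single k σ)⟩
  obtain ⟨hK, hcard⟩ := hc σ h0
  rw [boundary_succ_single]
  refine Submodule.sum_mem _ fun v hv τ hτ => ?_
  have hτ' : τ = σ.erase v := by
    by_contra hne
    exact hτ (Pi.single_eq_of_ne hne _)
  have hcv : (σ.erase v).card = k + 1 := by
    rw [Finset.card_erase_of_mem hv, hcard]; rfl
  subst hτ'
  exact ⟨(K.isRelLowerSet_faces hK).2 (Finset.erase_subset v σ)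
    (Finset.card_pos.1 (by omega)), hcv⟩

/-- The homology `H_k(K) = ker ∂_k / im ∂_{k+1}` with coefficients modulo 2. -/
abbrev Homology {V : Type*} [Fintype V] [DecidableEq V] (K : PreAbstractSimplicialComplex V) (k : ℕ) : Type _ :=
  ↥(cycles K k) ⧸ (boundaries K k).submoduleOf (cycles K k)

/-- The map `H_k(K) → H_k(L)` induced by an inclusion of complexes. -/
noncomputable def homologyMap {V : Type*} [Fintype V] [DecidableEq V] {K L : PreAbstractSimplicialComplex V}
    (h : K ≤ L) (k : ℕ) : Homology K k →ₗ[ZMod 2] Homology L k :=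
  Submodule.mapQ _ _ (Submodule.inclusion (cycles_mono h k)) fun _ hx => boundaries_mono h k hx

/-! ### Persistence barcodes -/

/-- The homology classes at threshold `b` that come from a threshold smaller than `b`. -/
noncomputable def bornBefore {V : Type*} [Fintype V] [DecidableEq V] (K : ℝ →o PreAbstractSimplicialComplex V)
    (k : ℕ) (b : ℝ) : Submodule (ZMod 2) (Homology (K b) k) :=
  ⨆ (a : ℝ) (h : a < b), LinearMap.range (homologyMap (K.monotone h.le) k)

/-- The homology classes at threshold `b` that become zero at threshold `d`. -/
noncomputable def deadAt {V : Type*} [Fintype V] [DecidableEq V] (K : ℝ →o PreAbstractSimplicialComplex V)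
    (k : ℕ) {b d : ℝ} (h : b ≤ d) : Submodule (ZMod 2) (Homology (K b) k) :=
  LinearMap.ker (homologyMap (K.monotone h) k)

/-- The homology classes at threshold `b` that become zero at a threshold smaller than `d`. -/
noncomputable def deadBefore {V : Type*} [Fintype V] [DecidableEq V] (K : ℝ →o PreAbstractSimplicialComplex V)
    (k : ℕ) (b d : ℝ) : Submodule (ZMod 2) (Homology (K b) k) :=
  ⨆ (c : ℝ) (h : b ≤ c ∧ c < d), deadAt K k h.1

/-- The multiplicity of the bar `[b, d)` in the `k`-th persistence barcode of the filtration `K`: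
the number of independent homology classes at threshold `b` that die at threshold `d`, modulo
those that die before `d` and those that are born before `b`. If the persistence module
`b ↦ H_k(K b)` is decomposed into interval modules, this is the number of intervals `[b, d)`. -/
noncomputable def barMultiplicity {V : Type*} [Fintype V] [DecidableEq V]
    (K : ℝ →o PreAbstractSimplicialComplex V) (k : ℕ) (b d : ℝ) : ℕ :=
  open scoped Classical in
  if h : b < d then
    Module.finrank (ZMod 2)
      (↥(deadAt K k h.le) ⧸
        (deadBefore K k b d ⊔ (bornBefore K k b ⊓ deadAt K k h.le)).submoduleOf (deadAt K k h.le))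
  else 0

/-- `l_k(K)`: the sum of the lengths of the bars of finite length, with multiplicity, in the `k`-th
persistence barcode of `K`. The sum has finite support for the Vietoris–Rips filtration of a
finite weighted graph, see `finite_bars`. -/
noncomputable def totalBarLength {V : Type*} [Fintype V] [DecidableEq V]
    (K : ℝ →o PreAbstractSimplicialComplex V) (k : ℕ) : ℝ :=
  ∑ᶠ p : ℝ × ℝ, (barMultiplicity K k p.1 p.2 : ℝ) * (p.2 - p.1)

/-! ### The auxiliary graph and the divergence -/

/-- The weights of the auxiliary graph of a pair of weighted graphs on the same numbered vertices
`1, …, N`, with weight matrices `w` and `w'`. It has two copies of the vertex set and one additional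
vertex, and the matrix of its weights is
`(w, w₊ᵀ, 0; w₊, min (w, w'), ∞; 0, ∞, 0)`,
where `w₊` is `w` with the entries strictly below the diagonal replaced by `∞`. -/
noncomputable def crossWeights {N : ℕ} (w w' : Fin N → Fin N → ℝ) :
    Fin N ⊕ Fin N ⊕ Unit → Fin N ⊕ Fin N ⊕ Unit → EReal
  | .inl i, .inl j => w i j
  | .inl j, .inr (.inl i) => if i ≤ j then (w i j : EReal) else ⊤
  | .inl _, .inr (.inr _) => 0
  | .inr (.inl i), .inl j => if i ≤ j then (w i j : EReal) else ⊤
  | .inr (.inl i), .inr (.inl j) => (min (w i j) (w' i j) : ℝ)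
  | .inr (.inl _), .inr (.inr _) => ⊤
  | .inr (.inr _), .inl _ => 0
  | .inr (.inr _), .inr (.inl _) => ⊤
  | .inr (.inr _), .inr (.inr _) => 0

/-- `RTD_k(w, w')`: the sum of the lengths of the finite bars in the `k`-th persistence barcode of the
Vietoris–Rips filtration of the auxiliary graph. -/
noncomputable def rtd {N : ℕ} (k : ℕ) (w w' : Fin N → Fin N → ℝ) : ℝ :=
  totalBarLength (vietorisRipsFiltration (crossWeights w w')) k

/-- `l_k(VR(G^w))` for the graph `G^w` with real edge weights `w`. -/
noncomputable def vrLength {N : ℕ} (k : ℕ) (w : Fin N → Fin N → ℝ) : ℝ :=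
  totalBarLength (vietorisRipsFiltration fun i j => (w i j : EReal)) k

/-! ### The sums above are finite -/

theorem homologyMap_surjective {V : Type*} [Fintype V] [DecidableEq V] {K L : PreAbstractSimplicialComplex V}
    (h : K ≤ L) (h' : L ≤ K) (k : ℕ) : Function.Surjective (homologyMap h k) := by
  obtain rfl := le_antisymm h h'
  intro x
  obtain ⟨y, rfl⟩ := Submodule.Quotient.mk_surjective _ x
  exact ⟨Submodule.Quotient.mk y, rfl⟩

theorem homologyMap_comp {V : Type*} [Fintype V] [DecidableEq V] {K L M : PreAbstractSimplicialComplex V}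
    (h : K ≤ L) (h' : L ≤ M) (k : ℕ) (x : Homology K k) :
    homologyMap h' k (homologyMap h k x) = homologyMap (h.trans h') k x := by
  obtain ⟨y, rfl⟩ := Submodule.Quotient.mk_surjective _ x
  rfl

theorem homologyMap_injective {V : Type*} [Fintype V] [DecidableEq V] {K L : PreAbstractSimplicialComplex V}
    (h : K ≤ L) (h' : L ≤ K) (k : ℕ) : Function.Injective (homologyMap h k) := by
  obtain rfl := le_antisymm h h'
  intro x y hxy
  obtain ⟨x, rfl⟩ := Submodule.Quotient.mk_surjective _ x
  obtain ⟨y, rfl⟩ := Submodule.Quotient.mk_surjective _ y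
  exact hxy

/-- A Vietoris–Rips complex does not change just before a threshold that is not a weight. -/
theorem exists_lt_vietorisRips_le {V : Type*} [Fintype V] (m : V → V → EReal) (a b : ℝ)
    (hab : a < b) (hb : ∀ x y, m x y ≠ (b : EReal)) :
    ∃ c, a ≤ c ∧ c < b ∧ vietorisRips m b ≤ vietorisRips m c := by
  have key : ∀ x y, ∀ᶠ c : ℝ in nhdsWithin b (Set.Iio b),
      m x y ≤ (b : EReal) → m x y ≤ (c : EReal) := by
    intro x y
    by_cases h : m x y < (b : EReal)
    · have h1 : ∀ᶠ c : ℝ in nhdsWithin b (Set.Iio b), m x y < (c : EReal) :=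
        nhdsWithin_le_nhds
          (continuous_coe_real_ereal.continuousAt.eventually (lt_mem_nhds h))
      filter_upwards [h1] with c hc _ using hc.le
    · exact Filter.Eventually.of_forall fun c h' => absurd (lt_of_le_of_ne h' (hb x y)) h
  have h2 : ∀ᶠ c : ℝ in nhdsWithin b (Set.Iio b),
      (∀ x y, m x y ≤ (b : EReal) → m x y ≤ (c : EReal)) := by
    rw [Filter.eventually_all]
    intro x
    rw [Filter.eventually_all]
    exact key x
  obtain ⟨c, hc, hc'⟩ := (h2.and (Ioo_mem_nhdsLT hab)).exists
  exact ⟨c, hc'.1.le, hc'.2, fun σ hσ => ⟨hσ.1, fun x hx y hy => hc x y (hσ.2 x hx y hy)⟩⟩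

/-- The barcode of the Vietoris–Rips filtration of a finite weighted graph has finitely many bars
of finite length. -/
theorem finite_bars {V : Type*} [Fintype V] [DecidableEq V] (m : V → V → EReal) (k : ℕ) :
    {p : ℝ × ℝ | barMultiplicity (vietorisRipsFiltration m) k p.1 p.2 ≠ 0}.Finite := by
  have hfin : {r : ℝ | ∃ x y, m x y = (r : EReal)}.Finite := by
    refine (Set.finite_range fun p : V × V => (m p.1 p.2).toReal).subset ?_
    rintro r ⟨x, y, h⟩
    exact ⟨(x, y), by simp [h]⟩
  refine (hfin.prod hfin).subset ?_
  rintro ⟨b, d⟩ hp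
  simp only [Set.mem_ofPred_eq, barMultiplicity] at hp
  split_ifs at hp with hbd
  swap
  · exact absurd rfl hp
  have hne : ¬ deadAt (vietorisRipsFiltration m) k hbd.le ≤
      deadBefore (vietorisRipsFiltration m) k b d ⊔
        (bornBefore (vietorisRipsFiltration m) k b ⊓
          deadAt (vietorisRipsFiltration m) k hbd.le) := by
    intro hle
    apply hp
    rw [Submodule.submoduleOf_eq_top.2 hle]
    exact Module.finrank_zero_of_subsingleton
  refine ⟨?_, ?_⟩ <;> by_contra hc <;> apply hne
  · obtain ⟨a, -, hab, hle⟩ := exists_lt_vietorisRips_le m (b - 1) b (by linarith)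
      (fun x y h => hc ⟨x, y, h⟩)
    refine le_sup_of_le_right (le_inf ?_ le_rfl)
    refine le_trans le_top (le_trans (le_of_eq ?_) (le_iSup₂ (f := fun (a : ℝ) (h : a < b) =>
      LinearMap.range (homologyMap ((vietorisRipsFiltration m).monotone h.le) k)) a hab))
    exact (LinearMap.range_eq_top.2 (homologyMap_surjective _ hle k)).symm
  · obtain ⟨c, hbc, hcd, hle⟩ := exists_lt_vietorisRips_le m b d hbd
      (fun x y h => hc ⟨x, y, h⟩)
    refine le_sup_of_le_left (le_trans ?_ (le_iSup₂ (f := fun (c : ℝ) (h : b ≤ c ∧ c < d) =>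
      deadAt (vietorisRipsFiltration m) k h.1) c ⟨hbc, hcd⟩))
    intro x hx
    refine LinearMap.mem_ker.2 (homologyMap_injective
      ((vietorisRipsFiltration m).monotone hcd.le) hle k ?_)
    rw [homologyMap_comp, map_zero]
    exact hx

/-- The total bar length vanishes in every degree that is at least the number of vertices. -/
theorem totalBarLength_eq_zero {V : Type*} [Fintype V] [DecidableEq V]
    (K : ℝ →o PreAbstractSimplicialComplex V) (k : ℕ) (hk : Fintype.card V ≤ k) :
    totalBarLength K k = 0 := by
  have hbot : ∀ a, cycles (K a) k = ⊥ := by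
    intro a
    refine eq_bot_iff.2 fun c hc => funext fun σ => ?_
    by_contra h0
    have h1 := (hc.1 σ h0).2
    have h2 := σ.card_le_univ
    omega
  have hsub : ∀ a, Subsingleton (Homology (K a) k) := by
    intro a
    have : Subsingleton ↥(cycles (K a) k) := by
      rw [hbot a]; infer_instance
    exact (Submodule.Quotient.mk_surjective _).subsingleton
  have hz : ∀ b d, barMultiplicity K k b d = 0 := by
    intro b d
    rw [barMultiplicity]
    split_ifs with h
    · have := hsub b
      have : Subsingleton ↥(deadAt K k h.le) := inferInstance
      have := (Submodule.Quotient.mk_surjective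
        ((deadBefore K k b d ⊔ (bornBefore K k b ⊓ deadAt K k h.le)).submoduleOf
          (deadAt K k h.le))).subsingleton
      exact Module.finrank_zero_of_subsingleton
    · rfl
  simp [totalBarLength, hz]

end RTD

/-!
The alternating sum of the lengths of the finite bars of a filtration is an integral of Euler
characteristics. The number of bars `[b, d)` is a second difference of the dimensions of the
kernels `ker (H_k(K_a) → H_k(K_b))` (`barMultiplicity_eq`), so summation by parts shows that `l_k`
integrates over the thresholds `a` the dimension of the space of classes in `H_k(K_a)` that vanish
eventually (`IsThresholds.totalBarLength_eq`). If there are vertices, the three complexes at large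
thresholds are cones, or a union of two cones along a cone, and hence have no reduced homology
(`isAcyclic_vietorisRips_crossWeights`). So every reduced class vanishes eventually, and
the alternating sum of these dimensions is the reduced Euler characteristic of the complex at
threshold `a`, if it is nonempty, which is computed by counting simplices with signs
(`dyingEuler_eq_neg_signedCount`). For `a < 0` the complexes are empty and contribute nothing.

It remains to compare, for each `a ≥ 0`, the signed numbers of simplices, the empty simplex
included (`signedCount_crossWeights`). In the auxiliary complex the simplices that contain the
additional vertex are in bijection with the simplices for `w`, in one dimension less, and those
inside the second copy of the vertices are the simplices for `min (w, w')`. Any other simplex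
consists of a nonempty `σ` in the first copy and a `τ` in the second copy whose vertices precede
those of `σ`; such simplices cancel in pairs by adding to `τ`, or removing from it, the first
vertex of `σ`.
-/

namespace RTD

/-! ### Multiplicities of bars as second differences -/

section LinearAlgebra

variable {F U V W X : Type*} [Field F] [AddCommGroup U] [Module F U] [AddCommGroup V] [Module F V]
  [AddCommGroup W] [Module F W] [AddCommGroup X] [Module F X]

theorem finrank_quotient_submoduleOf_add [FiniteDimensional F V] {S B : Submodule F V}
    (h : S ≤ B) :
    Module.finrank F (↥B ⧸ S.submoduleOf B) + Module.finrank F S = Module.finrank F B := by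
  rw [← Submodule.finrank_quotient_add_finrank (S.submoduleOf B),
    (Submodule.submoduleOfEquivOfLe h).finrank_eq]

theorem finrank_range_inf_ker_add [FiniteDimensional F U] (f : U →ₗ[F] V) (g : V →ₗ[F] W) :
    Module.finrank F ↥(LinearMap.range f ⊓ LinearMap.ker g) + Module.finrank F (LinearMap.ker f)
      = Module.finrank F (LinearMap.ker (g ∘ₗ f)) := by
  have h1 : LinearMap.range (f.domRestrict (LinearMap.ker (g ∘ₗ f)))
      = LinearMap.range f ⊓ LinearMap.ker g := by
    rw [LinearMap.range_domRestrict, LinearMap.ker_comp, Submodule.map_comap_eq]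
  have h2 : LinearMap.ker (f.domRestrict (LinearMap.ker (g ∘ₗ f)))
      = (LinearMap.ker f).submoduleOf (LinearMap.ker (g ∘ₗ f)) := by
    ext x; rfl
  have h := LinearMap.finrank_range_add_finrank_ker (f.domRestrict (LinearMap.ker (g ∘ₗ f)))
  rwa [h1, h2, (Submodule.submoduleOfEquivOfLe (LinearMap.ker_le_ker_comp f g)).finrank_eq] at h

/-- For `U → V → W → X`, the number of independent vectors of `V` that vanish in `X`, modulo those
that vanish in `W` and those that come from `U`, is a second difference of dimensions of kernels. -/
theorem finrank_ker_quotient_add [FiniteDimensional F U] [FiniteDimensional F V]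
    (f : U →ₗ[F] V) (g : V →ₗ[F] W) (h : W →ₗ[F] X) :
    Module.finrank F (↥(LinearMap.ker (h ∘ₗ g)) ⧸
        (LinearMap.ker g ⊔ (LinearMap.range f ⊓ LinearMap.ker (h ∘ₗ g))).submoduleOf
          (LinearMap.ker (h ∘ₗ g)))
      + Module.finrank F (LinearMap.ker g) + Module.finrank F (LinearMap.ker (h ∘ₗ g ∘ₗ f))
      = Module.finrank F (LinearMap.ker (h ∘ₗ g)) + Module.finrank F (LinearMap.ker (g ∘ₗ f)) := by
  have hle : LinearMap.ker g ≤ LinearMap.ker (h ∘ₗ g) := LinearMap.ker_le_ker_comp g h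
  have e1 := finrank_quotient_submoduleOf_add
    (sup_le hle (inf_le_right : LinearMap.range f ⊓ LinearMap.ker (h ∘ₗ g) ≤ _))
  have e2 := Submodule.finrank_sup_add_finrank_inf_eq (LinearMap.ker g)
    (LinearMap.range f ⊓ LinearMap.ker (h ∘ₗ g))
  have e3 : LinearMap.ker g ⊓ (LinearMap.range f ⊓ LinearMap.ker (h ∘ₗ g))
      = LinearMap.range f ⊓ LinearMap.ker g := by
    rw [inf_left_comm, inf_eq_left.2 hle]
  rw [e3] at e2
  have e4 := finrank_range_inf_ker_add f g
  have e5 := finrank_range_inf_ker_add f (h ∘ₗ g)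
  rw [LinearMap.comp_assoc] at e5
  omega

/-- The kernel of the map `Z / B → Z' / B'` induced by an inclusion is `(Z ⊓ B') / B`. -/
theorem finrank_ker_mapQ_inclusion_add [FiniteDimensional F V] {B Z B' Z' : Submodule F V}
    (hB : B ≤ Z) (hZ : Z ≤ Z') (hBB : B ≤ B')
    (h : B.submoduleOf Z ≤ (B'.submoduleOf Z').comap (Submodule.inclusion hZ)) :
    Module.finrank F (LinearMap.ker
        ((B.submoduleOf Z).mapQ (B'.submoduleOf Z') (Submodule.inclusion hZ) h))
      + Module.finrank F B = Module.finrank F ↥(Z ⊓ B') := by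
  have hker : LinearMap.ker ((B.submoduleOf Z).mapQ (B'.submoduleOf Z') (Submodule.inclusion hZ) h)
      = (B'.submoduleOf Z).map (B.submoduleOf Z).mkQ := by
    rw [Submodule.ker_mapQ]; rfl
  have h1 : LinearMap.range ((B.submoduleOf Z).mkQ.domRestrict (B'.submoduleOf Z))
      = (B'.submoduleOf Z).map (B.submoduleOf Z).mkQ := LinearMap.range_domRestrict _ _
  have h2 : LinearMap.ker ((B.submoduleOf Z).mkQ.domRestrict (B'.submoduleOf Z))
      = (B.submoduleOf Z).submoduleOf (B'.submoduleOf Z) := by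
    ext x
    exact Submodule.Quotient.mk_eq_zero _
  have h3 := LinearMap.finrank_range_add_finrank_ker
    ((B.submoduleOf Z).mkQ.domRestrict (B'.submoduleOf Z))
  have h4 : B.submoduleOf Z ≤ B'.submoduleOf Z := fun _ hx => hBB hx
  have h5 : B'.submoduleOf Z = (Z ⊓ B').submoduleOf Z := by
    ext x; simp [Submodule.submoduleOf]
  rw [h1, h2, ← hker, (Submodule.submoduleOfEquivOfLe h4).finrank_eq,
    (Submodule.submoduleOfEquivOfLe hB).finrank_eq, h5,
    (Submodule.submoduleOfEquivOfLe (inf_le_left : Z ⊓ B' ≤ Z)).finrank_eq] at h3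
  exact h3

end LinearAlgebra

section Filtration

variable {V : Type*} [Fintype V] [DecidableEq V]

/-- The number of independent `k`-dimensional homology classes at threshold `a` that vanish at
threshold `b`, expressed through cycles and boundaries. -/
noncomputable def dyingDim (K : ℝ →o PreAbstractSimplicialComplex V) (k : ℕ) (a b : ℝ) : ℝ :=
  Module.finrank (ZMod 2) ↥(cycles (K a) k ⊓ boundaries (K b) k)
    - Module.finrank (ZMod 2) (boundaries (K a) k)

theorem finrank_ker_homologyMap (K : ℝ →o PreAbstractSimplicialComplex V) (k : ℕ) {a b : ℝ}
    (h : a ≤ b) :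
    (Module.finrank (ZMod 2) (LinearMap.ker (homologyMap (K.monotone h) k)) : ℝ)
      = dyingDim K k a b := by
  have := finrank_ker_mapQ_inclusion_add (boundaries_le_cycles (K a) k)
    (cycles_mono (K.monotone h) k) (boundaries_mono (K.monotone h) k)
    (fun _ hx => boundaries_mono (K.monotone h) k hx)
  rw [dyingDim, ← this]
  rw [Nat.cast_add, add_sub_cancel_right]
  rfl

theorem dyingDim_self (K : ℝ →o PreAbstractSimplicialComplex V) (k : ℕ) (a : ℝ) :
    dyingDim K k a a = 0 := by
  rw [dyingDim, inf_eq_right.2 (boundaries_le_cycles _ _), sub_self]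

theorem homologyMap_comp' {K L M : PreAbstractSimplicialComplex V}
    (h : K ≤ L) (h' : L ≤ M) (k : ℕ) :
    homologyMap h' k ∘ₗ homologyMap h k = homologyMap (h.trans h') k :=
  LinearMap.ext (homologyMap_comp h h' k)

/-- If the filtration is constant on `[c, d)`, the classes that die before `d` are those that are
dead at `c`. -/
theorem deadBefore_eq (K : ℝ →o PreAbstractSimplicialComplex V) (k : ℕ) {b c d : ℝ}
    (hbc : b ≤ c) (hcd : c < d) (hK : ∀ a < d, K a ≤ K c) :
    deadBefore K k b d = deadAt K k hbc := by
  refine le_antisymm (iSup₂_le fun e he x hx => ?_) (le_iSup₂ (f := fun (c : ℝ)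
    (h : b ≤ c ∧ c < d) => deadAt K k h.1) c ⟨hbc, hcd⟩)
  have hx' : homologyMap (K.monotone he.1) k x = 0 := hx
  have h2 := homologyMap_comp (K.monotone he.1) (hK e he.2) k x
  rw [hx', map_zero] at h2
  exact h2.symm

/-- If the filtration is constant on `[a, b)`, the classes born before `b` come from `a`. -/
theorem bornBefore_eq (K : ℝ →o PreAbstractSimplicialComplex V) (k : ℕ) {a b : ℝ}
    (hab : a < b) (hK : ∀ c < b, K c ≤ K a) :
    bornBefore K k b = LinearMap.range (homologyMap (K.monotone hab.le) k) := by
  refine le_antisymm (iSup₂_le fun e he => ?_) (le_iSup₂ (f := fun (a : ℝ) (h : a < b) =>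
      LinearMap.range (homologyMap (K.monotone h.le) k)) a hab)
  rw [← homologyMap_comp' (hK e he) (K.monotone hab.le)]
  exact LinearMap.range_comp_le_range _ _

/-- If the filtration jumps at `b` only from its value at `a`, and at `d` only from its value at
`c`, the multiplicity of the bar `[b, d)` is a second difference. -/
theorem barMultiplicity_eq (K : ℝ →o PreAbstractSimplicialComplex V) (k : ℕ) {a b c d : ℝ}
    (hab : a < b) (hbc : b ≤ c) (hcd : c < d) (hKb : ∀ e < b, K e ≤ K a)
    (hKd : ∀ e < d, K e ≤ K c) :
    (barMultiplicity K k b d : ℝ)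
      = dyingDim K k b d - dyingDim K k b c - dyingDim K k a d + dyingDim K k a c := by
  have hbd : b < d := hbc.trans_lt hcd
  rw [barMultiplicity, dif_pos hbd, deadBefore_eq K k hbc hcd hKd, bornBefore_eq K k hab hKb]
  have hab' : K a ≤ K b := K.monotone hab.le
  have hbc' : K b ≤ K c := K.monotone hbc
  have hcd' : K c ≤ K d := K.monotone hcd.le
  have h := finrank_ker_quotient_add (homologyMap hab' k) (homologyMap hbc' k) (homologyMap hcd' k)
  rw [homologyMap_comp' hab' hbc', homologyMap_comp' hbc' hcd',
    homologyMap_comp' (hab'.trans hbc') hcd'] at h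
  have h' := congrArg (Nat.cast (R := ℝ)) h
  push_cast at h'
  rw [finrank_ker_homologyMap K k hbc, finrank_ker_homologyMap K k hbd.le,
    finrank_ker_homologyMap K k (hab.le.trans hbc),
    finrank_ker_homologyMap K k (hab.le.trans hbd.le)] at h'
  have h'' : ∀ q x y z u : ℝ, q + x + y = z + u → q = z - x - y + u := by intros; linarith
  exact h'' _ _ _ _ _ h'

end Filtration

/-! ### The total length of the bars -/

theorem sum_diff_mul (g t : ℕ → ℝ) (T : ℝ) (m : ℕ) :
    ∑ i ∈ Finset.range m, (g (i + 1) - g i) * (T - t (i + 1))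
      = g m * (T - t m) - g 0 * (T - t 0) + ∑ s ∈ Finset.range m, (t (s + 1) - t s) * g s := by
  induction m with
  | zero => simp
  | succ m ih => rw [Finset.sum_range_succ, Finset.sum_range_succ, ih]; ring

/-- Summation by parts in both variables. -/
theorem sum_second_diff_mul (κ : ℕ → ℕ → ℝ) (t : ℕ → ℝ) (h0 : ∀ j, κ 0 j = 0)
    (hd : ∀ j, κ j j = 0) (n : ℕ) :
    ∑ j ∈ Finset.range n, ∑ i ∈ Finset.range j,
        (κ (i + 1) (j + 1) - κ (i + 1) j - κ i (j + 1) + κ i j) * (t (j + 1) - t (i + 1))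
      = ∑ s ∈ Finset.range n, (t (s + 1) - t s) * κ s n := by
  induction n with
  | zero => simp
  | succ n ih =>
    rw [Finset.sum_range_succ, ih, Finset.sum_range_succ]
    have h := sum_diff_mul (fun i => κ i (n + 1) - κ i n) t (t (n + 1)) n
    simp only [h0, hd, sub_zero, zero_mul, mul_sub, Finset.sum_sub_distrib] at h
    rw [Finset.sum_congr rfl fun i _ => show
      (κ (i + 1) (n + 1) - κ (i + 1) n - κ i (n + 1) + κ i n) * (t (n + 1) - t (i + 1))
        = (κ (i + 1) (n + 1) - κ (i + 1) n - (κ i (n + 1) - κ i n)) * t (n + 1)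
          - (κ (i + 1) (n + 1) - κ (i + 1) n - (κ i (n + 1) - κ i n)) * t (i + 1) by ring,
      Finset.sum_sub_distrib, h]
    ring

theorem exists_strictMono_image_range (S : Finset ℝ) :
    ∃ (n : ℕ) (t : ℕ → ℝ), StrictMono t ∧ S = (Finset.range n).image t := by
  induction S using Finset.induction_on_max with
  | empty => exact ⟨0, fun i => i, Nat.strictMono_cast, rfl⟩
  | insert a S ha ih =>
    obtain ⟨n, t, ht, rfl⟩ := ih
    refine ⟨n + 1, fun i => if i < n then t i else a + (i - n : ℕ), fun i j hij => ?_, ?_⟩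
    · dsimp only
      split_ifs with h1 h2 h2
      · exact ht hij
      · have := ha (t i) (Finset.mem_image_of_mem _ (Finset.mem_range.2 h1))
        have : (0 : ℝ) ≤ (j - n : ℕ) := Nat.cast_nonneg _
        linarith
      · omega
      · have : i - n < j - n := by omega
        gcongr
    · rw [Finset.range_add_one, Finset.image_insert]
      simp only [lt_irrefl, if_false, Nat.sub_self, Nat.cast_zero, add_zero]
      congr 1
      refine Finset.image_congr fun i hi => ?_
      simp [Finset.mem_range.1 hi]

/-- The thresholds `t 0 < t 1 < ⋯` exhaust the values of the non-negative weights `m`: `t 0` is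
negative, and every finite weight is one of `t 1, …, t n`. -/
structure IsThresholds {V : Type*} (m : V → V → EReal) (t : ℕ → ℝ) (n : ℕ) : Prop where
  strictMono : StrictMono t
  neg : t 0 < 0
  nonneg : ∀ x y, 0 ≤ m x y
  exists_eq : ∀ x y (r : ℝ), m x y = r → ∃ i < n, r = t (i + 1)

section Bars

variable {V : Type*} {m : V → V → EReal} {t : ℕ → ℝ} {n : ℕ}

/-- The filtration is constant between consecutive thresholds. -/
theorem IsThresholds.le (h : IsThresholds m t n) (i : ℕ) (a : ℝ) (ha : a < t (i + 1)) :
    vietorisRipsFiltration m a ≤ vietorisRipsFiltration m (t i) := by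
  rintro σ ⟨hσ, hle⟩
  refine ⟨hσ, fun x hx y hy => ?_⟩
  have h1 := hle x hx y hy
  have htop : m x y ≠ ⊤ := fun h2 => by simp [h2] at h1
  have hbot : m x y ≠ ⊥ := fun h2 => by simpa [h2] using h.nonneg x y
  obtain ⟨r, hr⟩ : ∃ r : ℝ, m x y = r := ⟨_, (EReal.coe_toReal htop hbot).symm⟩
  obtain ⟨j, -, rfl⟩ := h.exists_eq x y r hr
  rw [hr, EReal.coe_le_coe_iff] at h1
  rw [hr, EReal.coe_le_coe_iff]
  have := h.strictMono.lt_iff_lt.1 (h1.trans_lt ha)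
  exact h.strictMono.monotone (by omega)

theorem notMem_vietorisRips_of_neg (hm : ∀ x y, 0 ≤ m x y) {a : ℝ} (ha : a < 0) (σ : Finset V) :
    σ ∉ vietorisRipsFiltration m a := by
  rintro ⟨⟨x, hx⟩, hle⟩
  have h : (0 : ℝ) ≤ a := EReal.coe_le_coe_iff.1 ((hm x x).trans (hle x hx x hx))
  exact absurd ha (not_lt.2 h)

theorem chains_eq_bot {K : PreAbstractSimplicialComplex V} (hK : ∀ σ, σ ∉ K) (k : ℕ) :
    chains K k = ⊥ :=
  eq_bot_iff.2 fun _ hc => funext fun σ => by_contra fun h => hK σ (hc σ h).1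

variable [Fintype V] [DecidableEq V]

/-- The endpoints of a bar of finite length are weights. -/
theorem exists_weight_of_barMultiplicity_ne_zero {k : ℕ} {b d : ℝ}
    (hp : barMultiplicity (vietorisRipsFiltration m) k b d ≠ 0) :
    b < d ∧ (∃ x y, m x y = (b : EReal)) ∧ ∃ x y, m x y = (d : EReal) := by
  rw [barMultiplicity] at hp
  split_ifs at hp with hbd
  swap
  · exact absurd rfl hp
  have hne : ¬ deadAt (vietorisRipsFiltration m) k hbd.le ≤
      deadBefore (vietorisRipsFiltration m) k b d ⊔
        (bornBefore (vietorisRipsFiltration m) k b ⊓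
          deadAt (vietorisRipsFiltration m) k hbd.le) := by
    intro hle
    apply hp
    rw [Submodule.submoduleOf_eq_top.2 hle]
    exact Module.finrank_zero_of_subsingleton
  refine ⟨hbd, ?_, ?_⟩ <;> by_contra! hc <;> apply hne
  · obtain ⟨a, -, hab, hle⟩ := exists_lt_vietorisRips_le m (b - 1) b (by linarith) hc
    refine le_sup_of_le_right (le_inf ?_ le_rfl)
    refine le_trans le_top (le_trans (le_of_eq ?_) (le_iSup₂ (f := fun (a : ℝ) (h : a < b) =>
      LinearMap.range (homologyMap ((vietorisRipsFiltration m).monotone h.le) k)) a hab))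
    exact (LinearMap.range_eq_top.2 (homologyMap_surjective _ hle k)).symm
  · obtain ⟨c, hbc, hcd, hle⟩ := exists_lt_vietorisRips_le m b d hbd hc
    refine le_sup_of_le_left (le_trans ?_ (le_iSup₂ (f := fun (c : ℝ) (h : b ≤ c ∧ c < d) =>
      deadAt (vietorisRipsFiltration m) k h.1) c ⟨hbc, hcd⟩))
    intro x hx
    refine LinearMap.mem_ker.2 (homologyMap_injective
      ((vietorisRipsFiltration m).monotone hcd.le) hle k ?_)
    rw [homologyMap_comp, map_zero]
    exact hx

theorem dyingDim_of_forall_notMem {K : ℝ →o PreAbstractSimplicialComplex V} {a : ℝ}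
    (hK : ∀ σ, σ ∉ K a) (k : ℕ) (b : ℝ) : dyingDim K k a b = 0 := by
  have h1 : cycles (K a) k = ⊥ := eq_bot_iff.2 (inf_le_left.trans (chains_eq_bot hK k).le)
  have h2 : boundaries (K a) k = ⊥ := eq_bot_iff.2 ((boundaries_le_cycles _ _).trans h1.le)
  rw [dyingDim, h1, h2, bot_inf_eq, sub_self]

/-- The total length of the finite bars integrates, over the thresholds, the number of homology
classes that vanish eventually. -/
theorem IsThresholds.totalBarLength_eq (h : IsThresholds m t n) (k : ℕ) :
    totalBarLength (vietorisRipsFiltration m) k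
      = ∑ s ∈ Finset.range n, (t (s + 1) - t s)
          * dyingDim (vietorisRipsFiltration m) k (t s) (t n) := by
  rw [← sum_second_diff_mul (fun i j => dyingDim (vietorisRipsFiltration m) k (t i) (t j)) t
    (fun j => dyingDim_of_forall_notMem (notMem_vietorisRips_of_neg h.nonneg h.neg) k _)
    (fun j => dyingDim_self _ _ _), Finset.sum_sigma']
  rw [totalBarLength, finsum_eq_sum_of_support_subset (s := ((Finset.range n).sigma
    fun j => Finset.range j).image fun p => (t (p.2 + 1), t (p.1 + 1)))]
  · rw [Finset.sum_image]
    · refine Finset.sum_congr rfl fun p hp => ?_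
      simp only [Finset.mem_sigma, Finset.mem_range] at hp
      rw [barMultiplicity_eq (vietorisRipsFiltration m) k (h.strictMono (Nat.lt_succ_self p.2))
        (h.strictMono.monotone hp.2) (h.strictMono (Nat.lt_succ_self p.1)) (h.le p.2) (h.le p.1)]
    · rintro ⟨j, i⟩ - ⟨j', i'⟩ - hij
      simp only [Prod.mk.injEq, h.strictMono.injective.eq_iff] at hij
      obtain ⟨hi, hj⟩ := hij
      obtain rfl : i = i' := by omega
      obtain rfl : j = j' := by omega
      rfl
  · rintro ⟨b, d⟩ hp
    have hp' : barMultiplicity (vietorisRipsFiltration m) k b d ≠ 0 := by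
      rintro h0
      simp [h0] at hp
    obtain ⟨hbd, ⟨x, y, hb⟩, ⟨x', y', hd⟩⟩ := exists_weight_of_barMultiplicity_ne_zero hp'
    obtain ⟨i, -, rfl⟩ := h.exists_eq x y b hb
    obtain ⟨j, hj, rfl⟩ := h.exists_eq x' y' d hd
    have := h.strictMono.lt_iff_lt.1 hbd
    simp only [Finset.coe_image, Set.mem_image, Finset.mem_coe, Finset.mem_sigma, Finset.mem_range]
    exact ⟨⟨j, i⟩, ⟨hj, show i < j by omega⟩, rfl⟩

end Bars

/-! ### Cones and augmented cycles -/

section Cone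

variable {V : Type*} [DecidableEq V]

/-- The cone operator with apex `u`: it sends a simplex without `u` to its join with `u`, and a
simplex that contains `u` to zero. It acts on the empty simplex too. -/
def cone (u : V) : (Finset V → ZMod 2) →ₗ[ZMod 2] (Finset V → ZMod 2) where
  toFun c τ := if u ∈ τ then c (τ.erase u) else 0
  map_add' c c' := by ext τ; by_cases h : u ∈ τ <;> simp [h]
  map_smul' r c := by ext τ; by_cases h : u ∈ τ <;> simp [h]

theorem cone_apply (u : V) (c : Finset V → ZMod 2) (τ : Finset V) :
    cone u c τ = if u ∈ τ then c (τ.erase u) else 0 := rfl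

variable [Fintype V]

theorem boundary_apply (k : ℕ) (c : Finset V → ZMod 2) (τ : Finset V) :
    boundary (k + 1) c τ = ∑ v ∈ τᶜ, c (insert v τ) := by
  have h : boundary (k + 1) c τ
      = ∑ σ : Finset V, c σ * ∑ v ∈ σ, (Pi.single (σ.erase v) (1 : ZMod 2) : Finset V → ZMod 2) τ := by
    simp [boundary, Fintype.linearCombination_apply, Finset.sum_apply]
  rw [h]
  simp only [Finset.mul_sum, Pi.single_apply, mul_ite, mul_one, mul_zero]
  rw [Finset.sum_sigma', ← Finset.sum_filter]
  refine Finset.sum_bij' (fun p _ => p.2) (fun v _ => ⟨insert v τ, v⟩) ?_ ?_ ?_ ?_ ?_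
  · rintro ⟨σ, v⟩ h
    simp only [Finset.mem_filter, Finset.mem_sigma] at h
    simp [h.2]
  · intro v hv
    have hv' : v ∉ τ := by simpa using hv
    simp [Finset.erase_insert hv']
  · rintro ⟨σ, v⟩ h
    simp only [Finset.mem_filter, Finset.mem_sigma] at h
    simp [h.2, Finset.insert_erase h.1.2]
  · intro v _
    rfl
  · rintro ⟨σ, v⟩ h
    simp only [Finset.mem_filter, Finset.mem_sigma] at h
    simp [h.2, Finset.insert_erase h.1.2]

/-- The boundary operator of positive degree is the one of the augmented complex, in which `∅` is a
simplex of dimension `-1`; there the cone operator contracts. -/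
theorem boundary_cone_add (u : V) (c : Finset V → ZMod 2) :
    boundary 1 (cone u c) + cone u (boundary 1 c) = c := by
  ext τ
  rw [Pi.add_apply, boundary_apply, cone_apply]
  by_cases hu : u ∈ τ
  · rw [if_pos hu, boundary_apply]
    have h1 : (τ.erase u)ᶜ = insert u τᶜ := by
      ext x; by_cases hx : x = u <;> simp [hx]
    rw [h1, Finset.sum_insert (by simpa using hu), Finset.insert_erase hu]
    have h2 : ∀ v ∈ τᶜ, cone u c (insert v τ) = c (insert v (τ.erase u)) := by
      intro v hv
      have hvu : v ≠ u := by rintro rfl; simp [hu] at hv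
      rw [cone_apply, if_pos (Finset.mem_insert_of_mem hu), Finset.erase_insert_of_ne hvu]
    rw [Finset.sum_congr rfl h2, add_left_comm, CharTwo.add_self_eq_zero, add_zero]
  · rw [if_neg hu, add_zero, Finset.sum_eq_single u]
    · rw [cone_apply, if_pos (Finset.mem_insert_self u τ), Finset.erase_insert hu]
    · intro v _ hvu
      rw [cone_apply, if_neg]
      simp [hu, hvu.symm]
    · simp [hu]

theorem boundary_boundary (c : Finset V → ZMod 2) : boundary 1 (boundary 1 c) = 0 := by
  have h : (boundary 1 ∘ₗ boundary 1 : (Finset V → ZMod 2) →ₗ[ZMod 2] _) = 0 := by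
    refine LinearMap.pi_ext' fun σ => LinearMap.ext_ring ?_
    exact boundary_boundary_single 1 σ
  exact LinearMap.congr_fun h c

/-- The cycles of the augmented chain complex. They agree with the cycles in positive degree; in
degree zero they are the chains with an even number of vertices. -/
noncomputable def augmentedCycles (K : PreAbstractSimplicialComplex V) (k : ℕ) :
    Submodule (ZMod 2) (Finset V → ZMod 2) :=
  chains K k ⊓ LinearMap.ker (boundary 1)

/-- The vanishing of the augmented homology of a complex. The complex may be empty. -/
def IsAcyclic (K : PreAbstractSimplicialComplex V) : Prop :=
  ∀ k, augmentedCycles K k ≤ boundaries K k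

theorem isAcyclic_of_cone {K : PreAbstractSimplicialComplex V} (u : V)
    (hu : ∀ σ ∈ K, insert u σ ∈ K) : IsAcyclic K := by
  rintro k c ⟨hc, hc0⟩
  refine ⟨cone u c, ?_, ?_⟩
  · intro τ hτ
    rw [cone_apply] at hτ
    split_ifs at hτ with h
    · have h1 := hc _ hτ
      have h2 := hu _ h1.1
      rw [Finset.insert_erase h] at h2
      refine ⟨h2, ?_⟩
      rw [← Finset.insert_erase h, Finset.card_insert_of_notMem (by simp), h1.2]
    · exact absurd rfl hτ
  · have := boundary_cone_add u c
    rw [LinearMap.mem_ker.1 hc0, map_zero, add_zero] at this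
    exact this

/-- The cycles that bound in a larger acyclic complex are the augmented cycles, also in degree zero,
where every chain is a cycle. -/
theorem cycles_inf_boundaries {K L : PreAbstractSimplicialComplex V} (h : K ≤ L)
    (hL : IsAcyclic L) (k : ℕ) : cycles K k ⊓ boundaries L k = augmentedCycles K k := by
  refine le_antisymm ?_ fun c hc => ⟨⟨hc.1, ?_⟩, hL k ⟨chains_mono h k hc.1, hc.2⟩⟩
  · rintro c ⟨hc, ⟨d, -, rfl⟩⟩
    exact ⟨hc.1, boundary_boundary d⟩
  · cases k with
    | zero => simp [boundary]
    | succ k => exact hc.2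

/-! ### The reduced Euler characteristic -/

theorem finrank_chains {W : Type*} [Fintype W] (K : PreAbstractSimplicialComplex W) (k : ℕ) :
    Module.finrank (ZMod 2) (chains K k) = Nat.card {σ // σ ∈ K ∧ σ.card = k + 1} := by
  classical
  let e : chains K k ≃ₗ[ZMod 2] ({σ : Finset W // σ ∈ K ∧ σ.card = k + 1} → ZMod 2) :=
    { toFun := fun c σ => c.1 σ.1
      map_add' := fun _ _ => rfl
      map_smul' := fun _ _ => rfl
      invFun := fun f => ⟨fun σ => if h : σ ∈ K ∧ σ.card = k + 1 then f ⟨σ, h⟩ else 0, by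
        intro σ hσ
        by_contra h
        exact hσ (dif_neg h)⟩
      left_inv := by
        rintro ⟨c, hc⟩
        ext σ
        by_cases h : σ ∈ K ∧ σ.card = k + 1
        · simp [h]
        · have : c σ = 0 := by_contra fun h0 => h (hc σ h0)
          simp [h, this]
      right_inv := by
        intro f
        ext σ
        simp [σ.2] }
  rw [e.finrank_eq, Module.finrank_fintype_fun_eq_card, Nat.card_eq_fintype_card]

theorem finrank_map_boundary_add (K : PreAbstractSimplicialComplex V) (k : ℕ) :
    Module.finrank (ZMod 2) ((chains K k).map (boundary 1))
      + Module.finrank (ZMod 2) (augmentedCycles K k) = Module.finrank (ZMod 2) (chains K k) := by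
  have h := LinearMap.finrank_range_add_finrank_ker ((boundary 1).domRestrict (chains K k))
  have h2 : LinearMap.ker ((boundary 1).domRestrict (chains K k))
      = (augmentedCycles K k).submoduleOf (chains K k) := by
    ext x
    exact ⟨fun hx => ⟨x.2, hx⟩, fun hx => hx.2⟩
  have h3 : augmentedCycles K k ≤ chains K k := inf_le_left
  rwa [LinearMap.range_domRestrict, h2, (Submodule.submoduleOfEquivOfLe h3).finrank_eq] at h

/-- The augmentation of a nonempty complex has rank one. -/
theorem finrank_map_boundary_chains_zero {K : PreAbstractSimplicialComplex V} {v : V}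
    (hv : {v} ∈ K) : Module.finrank (ZMod 2) ((chains K 0).map (boundary 1)) = 1 := by
  have h : (chains K 0).map (boundary 1) = Submodule.span (ZMod 2) {Pi.single ∅ 1} := by
    refine le_antisymm ?_ ?_
    · rintro _ ⟨c, hc, rfl⟩
      rw [Submodule.mem_span_singleton]
      refine ⟨boundary 1 c ∅, ?_⟩
      ext τ
      by_cases hτ : τ = ∅
      · subst hτ; simp
      · rw [Pi.smul_apply, Pi.single_eq_of_ne hτ, smul_zero, boundary_apply, eq_comm]
        refine Finset.sum_eq_zero fun x hx => ?_
        by_contra h0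
        have h1 := (hc _ h0).2
        rw [Finset.card_insert_of_notMem (by simpa using hx)] at h1
        exact hτ (Finset.card_eq_zero.1 (by omega))
    · rw [Submodule.span_singleton_le_iff_mem]
      refine ⟨Pi.single {v} 1, ?_, ?_⟩
      · intro σ hσ
        by_cases h : σ = {v}
        · subst h; exact ⟨hv, by simp⟩
        · exact absurd (Pi.single_eq_of_ne h _) hσ
      · rw [boundary_succ_single]; simp
  rw [h, finrank_span_singleton]
  intro h0
  simpa using congrFun h0 ∅

/-- The Euler–Poincaré telescoping, with `A j` the number of simplices with `j` vertices and `z k` the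
dimension of the `k`-cycles, so that `A (k + 2) - z (k + 1)` is that of the `k`-boundaries. -/
theorem sum_alternating_augmented (A z : ℕ → ℝ) (hz : z 0 = A 1 - A 0) (M : ℕ) :
    ∑ k ∈ Finset.range M, (-1 : ℝ) ^ k * (z k - (A (k + 2) - z (k + 1)))
      = - (-1) ^ M * z M - ∑ j ∈ Finset.range (M + 2), (-1) ^ j * A j := by
  induction M with
  | zero => simp [Finset.sum_range_succ, hz]; ring
  | succ M ih =>
    rw [Finset.sum_range_succ, ih, Finset.sum_range_succ _ (M + 2)]
    ring

open scoped Classical in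
/-- The Euler characteristic of the augmented chain complex of a nonempty complex. -/
theorem sum_finrank_augmentedCycles_sub {K : PreAbstractSimplicialComplex V} {v : V}
    (hv : {v} ∈ K) {M : ℕ} (hM : Fintype.card V ≤ M) :
    ∑ k ∈ Finset.range M, (-1 : ℝ) ^ k * (Module.finrank (ZMod 2) (augmentedCycles K k)
        - Module.finrank (ZMod 2) (boundaries K k))
      = - ∑ σ : Finset V with σ = ∅ ∨ σ ∈ K, (-1 : ℝ) ^ σ.card := by
  set A : ℕ → ℝ := fun j =>
    (((Finset.univ.filter fun σ : Finset V => σ = ∅ ∨ σ ∈ K).filter fun σ => σ.card = j).card : ℝ)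
    with hA
  have hA0 : A 0 = 1 := by
    simp only [hA]
    rw [Nat.cast_eq_one, Finset.card_eq_one]
    refine ⟨∅, ?_⟩
    ext σ
    simp only [Finset.mem_filter, Finset.mem_univ, true_and, Finset.card_eq_zero,
      Finset.mem_singleton]
    tauto
  have hAs : ∀ k, A (k + 1) = Module.finrank (ZMod 2) (chains K k) := by
    intro k
    rw [finrank_chains, Nat.card_eq_fintype_card, Fintype.card_subtype]
    simp only [hA]
    congr 2
    ext σ
    simp only [Finset.mem_filter, Finset.mem_univ, true_and]
    refine ⟨fun h => ⟨h.1.resolve_left ?_, h.2⟩, fun h => ⟨Or.inr h.1, h.2⟩⟩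
    rintro rfl
    simp at h
  have hr : ∀ k, (Module.finrank (ZMod 2) (boundaries K k) : ℝ)
      = A (k + 2) - Module.finrank (ZMod 2) (augmentedCycles K (k + 1)) := by
    intro k
    rw [hAs (k + 1), ← finrank_map_boundary_add K (k + 1), Nat.cast_add, add_sub_cancel_right]
    rfl
  simp only [hr]
  have hz0 : (Module.finrank (ZMod 2) (augmentedCycles K 0) : ℝ) = A 1 - A 0 := by
    rw [hAs 0, ← finrank_map_boundary_add K 0, finrank_map_boundary_chains_zero hv, hA0]
    push_cast
    ring
  rw [sum_alternating_augmented A (fun k => Module.finrank (ZMod 2) (augmentedCycles K k)) hz0]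
  have hzM : Module.finrank (ZMod 2) (augmentedCycles K M) = 0 := by
    have : augmentedCycles K M = ⊥ := by
      refine eq_bot_iff.2 fun c hc => funext fun σ => by_contra fun h0 => ?_
      have h1 := (hc.1 σ h0).2
      have h2 := σ.card_le_univ
      omega
    rw [this, finrank_bot]
  rw [hzM, Nat.cast_zero, mul_zero, zero_sub]
  congr 1
  rw [← Finset.sum_fiberwise_of_maps_to (g := Finset.card) (t := Finset.range (M + 2))
    (fun σ _ => Finset.mem_range.2 (by have := σ.card_le_univ; omega))]
  refine Finset.sum_congr rfl fun j _ => ?_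
  rw [Finset.sum_congr rfl fun σ hσ => by rw [(Finset.mem_filter.1 hσ).2], Finset.sum_const,
    nsmul_eq_mul, mul_comm]

end Cone

/-! ### Alternating sums of bar lengths -/

section Alternating

variable {V : Type*} [Fintype V] {m : V → V → EReal} {t : ℕ → ℝ} {n : ℕ}

open scoped Classical in
/-- The alternating number of simplices of the Vietoris–Rips complex, the empty simplex included:
minus the reduced Euler characteristic, if the complex is nonempty. -/
noncomputable def signedCount (m : V → V → EReal) (a : ℝ) : ℝ :=
  ∑ σ : Finset V, if ∀ x ∈ σ, ∀ y ∈ σ, m x y ≤ a then (-1 : ℝ) ^ σ.card else 0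

variable [DecidableEq V]

/-- The alternating sum of the dimensions of the homology of the complex at threshold `a` which
vanishes at threshold `b`. -/
noncomputable def dyingEuler (m : V → V → EReal) (a b : ℝ) : ℝ :=
  ∑ k ∈ Finset.range (Fintype.card V), (-1 : ℝ) ^ k * dyingDim (vietorisRipsFiltration m) k a b

theorem dyingEuler_eq_neg_signedCount {a b : ℝ} (hab : a ≤ b)
    (hb : IsAcyclic (vietorisRips m b)) {v : V} (hv : m v v ≤ a) :
    dyingEuler m a b = - signedCount m a := by
  classical
  have hv' : {v} ∈ vietorisRips m a := ⟨Finset.singleton_nonempty v, by simpa using hv⟩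
  have h := sum_finrank_augmentedCycles_sub hv' le_rfl
  have hK : vietorisRips m a ≤ vietorisRips m b := (vietorisRipsFiltration m).monotone hab
  rw [dyingEuler, Finset.sum_congr rfl fun k _ => show _ = (-1 : ℝ) ^ k *
    (Module.finrank (ZMod 2) (augmentedCycles (vietorisRips m a) k)
      - Module.finrank (ZMod 2) (boundaries (vietorisRips m a) k) : ℝ) by
    rw [← cycles_inf_boundaries hK hb k]; rfl, h]
  rw [signedCount, Finset.sum_filter]
  congr 1
  refine Finset.sum_congr rfl fun σ _ => ?_
  congr 1
  refine propext ⟨?_, fun h => σ.eq_empty_or_nonempty.imp_right fun hσ => ⟨hσ, h⟩⟩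
  rintro (rfl | h)
  · simp
  · exact h.2

theorem dyingEuler_of_neg (hm : ∀ x y, 0 ≤ m x y) {a b : ℝ} (ha : a < 0) :
    dyingEuler m a b = 0 := by
  simp [dyingEuler, dyingDim_of_forall_notMem (notMem_vietorisRips_of_neg hm ha)]

theorem IsThresholds.finsum_totalBarLength_eq (h : IsThresholds m t n) :
    ∑ᶠ k : ℕ, (-1 : ℝ) ^ k * totalBarLength (vietorisRipsFiltration m) k
      = ∑ s ∈ Finset.range n, (t (s + 1) - t s) * dyingEuler m (t s) (t n) := by
  rw [finsum_eq_sum_of_support_subset (s := Finset.range (Fintype.card V))]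
  · simp only [h.totalBarLength_eq, dyingEuler, Finset.mul_sum]
    rw [Finset.sum_comm]
    exact Finset.sum_congr rfl fun _ _ => Finset.sum_congr rfl fun _ _ => by ring
  · intro k hk
    by_contra h0
    refine hk ?_
    dsimp only
    rw [totalBarLength_eq_zero _ _ (by simpa using h0), mul_zero]

end Alternating

/-! ### The auxiliary graph at large thresholds -/

/-- A complex is acyclic if the simplices that contain a vertex `a` form a complex with a further
apex `v`, and those that do not contain `a` form a cone with apex `u`. A cycle is cut into a chain
of simplices with `a` and a chain of simplices without `a`; their common boundary bounds a chain
`y`, a cone with apex `v`, and adding `y` to both makes them cycles of two cones. -/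
theorem isAcyclic_of_union_of_cones {V : Type*} [Fintype V] [DecidableEq V]
    {K : PreAbstractSimplicialComplex V} {a u v : V} (hva : v ≠ a)
    (hv : ∀ σ ∈ K, a ∈ σ → insert v σ ∈ K) (hu : ∀ σ ∈ K, a ∉ σ → insert u σ ∈ K) :
    IsAcyclic K := by
  rintro k c ⟨hc, hc0⟩
  set p : Finset V → ZMod 2 := fun σ => if a ∈ σ then c σ else 0 with hp
  set q : Finset V → ZMod 2 := fun σ => if a ∈ σ then 0 else c σ with hq
  have hpq : p + q = c := by
    ext σ; by_cases h : a ∈ σ <;> simp [hp, hq, h]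
  set z := boundary 1 q with hz
  have hzp : boundary 1 p = z := by
    have h : boundary 1 p + boundary 1 q = 0 := by rw [← map_add, hpq]; exact hc0
    rw [hz]; exact CharTwo.add_eq_zero.1 h
  -- The simplices of `z` are facets opposite to `a`: being the boundary of `q`, it avoids `a`, and
  -- being the boundary of `p`, it consists of facets of simplices with `a`.
  have hz1 : ∀ τ, z τ ≠ 0 → a ∉ τ ∧ insert a τ ∈ K ∧ τ.card = k := by
    intro τ hτ
    have haτ : a ∉ τ := by
      intro ha
      refine hτ ?_
      rw [hz, boundary_apply]
      exact Finset.sum_eq_zero fun x _ => by simp [hq, ha]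
    rw [← hzp, boundary_apply] at hτ
    obtain ⟨x, hx, hpx⟩ := Finset.exists_ne_zero_of_sum_ne_zero hτ
    simp only [hp] at hpx
    split_ifs at hpx with hax
    · obtain rfl : a = x := (Finset.mem_insert.1 hax).resolve_right haτ
      have h1 := hc _ hpx
      rw [Finset.card_insert_of_notMem haτ] at h1
      exact ⟨haτ, h1.1, by omega⟩
    · exact absurd rfl hpx
  set y := cone v z with hy
  have hy1 : ∀ ρ, y ρ ≠ 0 → a ∉ ρ ∧ insert a ρ ∈ K ∧ ρ ∈ K ∧ ρ.card = k + 1 := by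
    intro ρ hρ
    rw [hy, cone_apply] at hρ
    split_ifs at hρ with hvρ
    · obtain ⟨h1, h2, h3⟩ := hz1 _ hρ
      have h4 := hv _ h2 (Finset.mem_insert_self _ _)
      rw [Finset.insert_comm, Finset.insert_erase hvρ] at h4
      refine ⟨fun h => h1 (Finset.mem_erase.2 ⟨hva.symm, h⟩), h4,
        (K.isRelLowerSet_faces h4).2 (Finset.subset_insert _ _) ⟨v, hvρ⟩, ?_⟩
      rw [← Finset.insert_erase hvρ, Finset.card_insert_of_notMem (by simp), h3]
    · exact absurd rfl hρ
  have hDz : boundary 1 z = 0 := boundary_boundary q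
  have hDy : boundary 1 y = z := by
    have := boundary_cone_add v z
    rwa [hDz, map_zero, add_zero] at this
  have e1 : boundary 1 (cone a (p + y)) = p + y := by
    have := boundary_cone_add a (p + y)
    rwa [map_add (boundary 1) p, hzp, hDy, CharTwo.add_self_eq_zero, map_zero, add_zero] at this
  have e2 : boundary 1 (cone u (q + y)) = q + y := by
    have := boundary_cone_add u (q + y)
    rwa [map_add (boundary 1) q, ← hz, hDy, CharTwo.add_self_eq_zero, map_zero, add_zero] at this
  refine ⟨cone a (p + y) + cone u (q + y), Submodule.add_mem _ ?_ ?_, ?_⟩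
  · intro τ hτ
    rw [cone_apply] at hτ
    split_ifs at hτ with h
    -- The cone operator with apex `a` kills `p`.
    · have hpτ : p (τ.erase a) = 0 := by simp [hp]
      rw [Pi.add_apply, hpτ, zero_add] at hτ
      obtain ⟨h1, h2, -, h3⟩ := hy1 _ hτ
      rw [Finset.insert_erase h] at h2
      refine ⟨h2, ?_⟩
      rw [← Finset.insert_erase h, Finset.card_insert_of_notMem (by simp), h3]
    · exact absurd rfl hτ
  · intro τ hτ
    rw [cone_apply] at hτ
    split_ifs at hτ with h
    · have h1 : τ.erase u ∈ K ∧ (τ.erase u).card = k + 1 ∧ a ∉ τ.erase u := by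
        by_cases h0 : y (τ.erase u) = 0
        · rw [Pi.add_apply, h0, add_zero] at hτ
          simp only [hq] at hτ
          split_ifs at hτ with ha
          · exact absurd rfl hτ
          · exact ⟨(hc _ hτ).1, (hc _ hτ).2, ha⟩
        · obtain ⟨h1, -, h2, h3⟩ := hy1 _ h0
          exact ⟨h2, h3, h1⟩
      have h2 := hu _ h1.1 h1.2.2
      rw [Finset.insert_erase h] at h2
      refine ⟨h2, ?_⟩
      rw [← Finset.insert_erase h, Finset.card_insert_of_notMem (by simp), h1.2.1]
    · exact absurd rfl hτ
  · change boundary 1 _ = c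
    rw [map_add, e1, e2, add_add_add_comm, CharTwo.add_self_eq_zero, add_zero, hpq]

theorem insert_mem_vietorisRips {V : Type*} [DecidableEq V] {m : V → V → EReal} {a : ℝ}
    {σ : Finset V} {u : V} (hσ : σ ∈ vietorisRips m a) (huu : m u u ≤ a)
    (h : ∀ x ∈ σ, m u x ≤ a ∧ m x u ≤ a) : insert u σ ∈ vietorisRips m a := by
  refine ⟨Finset.insert_nonempty u σ, fun x hx y hy => ?_⟩
  rw [Finset.mem_insert] at hx hy
  rcases hx with rfl | hx <;> rcases hy with rfl | hy
  · exact huu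
  · exact (h y hy).1
  · exact (h x hx).2
  · exact hσ.2 x hx y hy

theorem isAcyclic_vietorisRips_of_forall_le {N : ℕ} {u : Fin N → Fin N → ℝ} (i : Fin N) {b : ℝ}
    (hu : ∀ i j, u i j ≤ b) : IsAcyclic (vietorisRips (fun i j => (u i j : EReal)) b) := by
  have h : ∀ i j, (u i j : EReal) ≤ b := fun i j => EReal.coe_le_coe_iff.2 (hu i j)
  exact isAcyclic_of_cone i fun σ hσ =>
    insert_mem_vietorisRips hσ (h i i) fun x _ => ⟨h i x, h x i⟩

theorem isAcyclic_vietorisRips_crossWeights {N : ℕ} {w w' : Fin N → Fin N → ℝ} {b : ℝ}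
    (hb : 0 ≤ b) (hw : ∀ i j, w i j ≤ b) : IsAcyclic (vietorisRips (crossWeights w w') b) := by
  have hb' : (0 : EReal) ≤ b := EReal.coe_le_coe_iff.2 hb
  have hw1 : ∀ i j, (w i j : EReal) ≤ b := fun i j => EReal.coe_le_coe_iff.2 (hw i j)
  have hw2 : ∀ i j, ((min (w i j) (w' i j) : ℝ) : EReal) ≤ b := fun i j =>
    EReal.coe_le_coe_iff.2 ((min_le_left _ _).trans (hw i j))
  obtain _ | N := N
  · refine isAcyclic_of_cone (.inr (.inr ())) fun σ hσ => insert_mem_vietorisRips hσ hb' ?_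
    rintro (i | i | i) -
    · exact i.elim0
    · exact i.elim0
    · exact ⟨hb', hb'⟩
  · refine isAcyclic_of_union_of_cones (a := .inr (.inr ())) (v := .inl 0) (u := .inr (.inl 0))
      (by simp) ?_ ?_
    · intro σ hσ ha
      refine insert_mem_vietorisRips hσ (hw1 0 0) ?_
      rintro (i | i | i) hi
      · exact ⟨hw1 0 i, hw1 i 0⟩
      · have h := hσ.2 _ ha _ hi
        exact absurd h (not_le.2 (EReal.coe_lt_top b))
      · exact ⟨hb', hb'⟩
    · intro σ hσ ha
      refine insert_mem_vietorisRips hσ (hw2 0 0) ?_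
      rintro (i | i | i) hi
      · simp [crossWeights, hw 0 i]
      · exact ⟨hw2 0 i, hw2 i 0⟩
      · exact absurd hi ha

/-! ### Counting the simplices of the auxiliary graph -/

/-- The signed count of the sets with a property cancels in pairs, if adding or removing `j` does not
affect the property. -/
theorem sum_signed_eq_zero_of_insert_iff {α : Type*} [Fintype α] [DecidableEq α]
    (Q : Finset α → Prop) [DecidablePred Q] (j : α)
    (h : ∀ τ, Q (insert j τ) ↔ Q τ) :
    ∑ τ : Finset α, (if Q τ then (-1 : ℝ) ^ τ.card else 0) = 0 := by
  refine Finset.sum_involution (fun τ _ => if j ∈ τ then τ.erase j else insert j τ) ?_ ?_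
    (fun _ _ => Finset.mem_univ _) ?_
  · intro τ _
    by_cases hj : j ∈ τ
    · have h1 : Q (τ.erase j) ↔ Q τ := by rw [← h, Finset.insert_erase hj]
      rw [if_pos hj, if_congr h1 rfl rfl, ← Finset.card_erase_add_one hj, pow_succ]
      split_ifs <;> ring
    · rw [if_neg hj, if_congr (h τ) rfl rfl, Finset.card_insert_of_notMem hj, pow_succ]
      split_ifs <;> ring
  · intro τ _ _ heq
    by_cases hj : j ∈ τ
    · rw [if_pos hj] at heq
      exact (Finset.notMem_erase j τ) (by rwa [heq])
    · rw [if_neg hj] at heq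
      exact hj (by rw [← heq]; exact Finset.mem_insert_self _ _)
  · intro τ _
    by_cases hj : j ∈ τ <;> simp [hj]

theorem forall_mem_disjSum {α β : Type*} {s : Finset α} {t : Finset β} {p : α ⊕ β → Prop} :
    (∀ x ∈ s.disjSum t, p x) ↔ (∀ x ∈ s, p (.inl x)) ∧ ∀ y ∈ t, p (.inr y) := by
  simp

/-- The simplices of the auxiliary complex: a simplex `σ` of the first graph, a simplex `τ` of the
second one whose vertices precede those of `σ`, and the apex or not; the apex excludes `τ`. -/
theorem forall_crossWeights_le_iff {N : ℕ} {w w' : Fin N → Fin N → ℝ} {a : ℝ} (ha : 0 ≤ a)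
    (σ τ : Finset (Fin N)) (ρ : Finset Unit) :
    (∀ x ∈ σ.disjSum (τ.disjSum ρ), ∀ y ∈ σ.disjSum (τ.disjSum ρ), crossWeights w w' x y ≤ a) ↔
      (∀ i ∈ σ, ∀ j ∈ σ, w i j ≤ a) ∧ ((∀ i ∈ τ, ∀ j ∈ τ, min (w i j) (w' i j) ≤ a) ∧
        ∀ i ∈ τ, ∀ j ∈ σ, i ≤ j ∧ w i j ≤ a) ∧ (τ = ∅ ∨ ρ = ∅) := by
  have ha' : (0 : EReal) ≤ a := EReal.coe_le_coe_iff.2 ha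
  have h1 : ∀ i j, (if i ≤ j then (w i j : EReal) else ⊤) ≤ a ↔ i ≤ j ∧ w i j ≤ a := by
    intro i j
    split_ifs with h <;> simp [h]
  simp only [forall_mem_disjSum, crossWeights, h1, EReal.coe_le_coe_iff, ha', top_le_iff,
    EReal.coe_ne_top]
  constructor
  · rintro ⟨hσ, hτ, hρ⟩
    refine ⟨fun i hi => (hσ i hi).1, ⟨fun i hi => (hτ i hi).2.1, fun i hi => (hτ i hi).1⟩, ?_⟩
    rw [or_iff_not_imp_left, ← ne_eq, ← Finset.nonempty_iff_ne_empty]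
    rintro ⟨i, hi⟩
    exact Finset.eq_empty_of_forall_notMem (hτ i hi).2.2
  · rintro ⟨hσ, ⟨hτ, hστ⟩, rfl | rfl⟩
    · exact ⟨fun i hi => ⟨hσ i hi, fun j hj => absurd hj (Finset.notMem_empty j),
        fun _ _ => trivial⟩, fun j hj => absurd hj (Finset.notMem_empty j),
        fun _ _ => ⟨fun _ _ => trivial, fun j hj => absurd hj (Finset.notMem_empty j),
          fun _ _ => trivial⟩⟩
    · exact ⟨fun i hi => ⟨hσ i hi, fun j hj => hστ j hj i hi, fun _ _ => trivial⟩,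
        fun i hi => ⟨hστ i hi, hτ i hi, fun x hx => absurd hx (Finset.notMem_empty x)⟩,
        fun x hx => absurd hx (Finset.notMem_empty x)⟩

theorem signedCount_coe {N : ℕ} (u : Fin N → Fin N → ℝ) (a : ℝ) :
    signedCount (fun i j => (u i j : EReal)) a
      = ∑ σ : Finset (Fin N), if ∀ i ∈ σ, ∀ j ∈ σ, u i j ≤ a then (-1 : ℝ) ^ σ.card else 0 := by
  classical
  simp only [signedCount, EReal.coe_le_coe_iff]

theorem sum_finset_sum {α β M : Type*} [Fintype α] [Fintype β] [AddCommMonoid M]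
    (f : Finset (α ⊕ β) → M) : ∑ σ, f σ = ∑ s, ∑ t, f (Finset.disjSum s t) := by
  rw [← Fintype.sum_prod_type' fun s t => f (Finset.disjSum s t)]
  exact (Finset.sumEquiv.symm.toEquiv.sum_comp f).symm

theorem sum_finset_unit {M : Type*} [AddCommMonoid M] (f : Finset Unit → M) :
    ∑ ρ, f ρ = f ∅ + f {()} := by
  have h : (Finset.univ : Finset (Finset Unit)) = {∅, {()}} := by decide
  rw [h, Finset.sum_pair (by decide)]

/-- If `j` is the first vertex of a nonempty simplex `σ` of the first copy, the copy of `j` in the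
second copy may be added to or removed from every simplex whose first part is `σ`. -/
theorem sum_signed_crossWeights_fiber {N : ℕ} {w w' : Fin N → Fin N → ℝ}
    (hw_symm : ∀ i j, w i j = w j i) (hw_diag : ∀ i, w i i = 0) {a : ℝ} (ha : 0 ≤ a)
    {σ : Finset (Fin N)} (hne : σ.Nonempty) (hσ : ∀ i ∈ σ, ∀ j ∈ σ, w i j ≤ a) :
    ∑ τ : Finset (Fin N), (if (∀ i ∈ τ, ∀ j ∈ τ, min (w i j) (w' i j) ≤ a) ∧
        ∀ i ∈ τ, ∀ j ∈ σ, i ≤ j ∧ w i j ≤ a then (-1 : ℝ) ^ τ.card else 0) = 0 := by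
  classical
  obtain ⟨j, hj, hmin⟩ : ∃ j ∈ σ, ∀ i ∈ σ, j ≤ i := ⟨σ.min' hne, σ.min'_mem hne, σ.min'_le⟩
  convert sum_signed_eq_zero_of_insert_iff (fun τ : Finset (Fin N) =>
    (∀ i ∈ τ, ∀ j ∈ τ, min (w i j) (w' i j) ≤ a) ∧ ∀ i ∈ τ, ∀ j ∈ σ, i ≤ j ∧ w i j ≤ a) j ?_
  refine fun τ => ⟨fun h => ?_, fun h => ?_⟩
  · exact ⟨fun i hi k hk => h.1 i (Finset.mem_insert_of_mem hi) k (Finset.mem_insert_of_mem hk),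
      fun i hi => h.2 i (Finset.mem_insert_of_mem hi)⟩
  · refine ⟨fun i hi k hk => ?_, fun i hi k hk => ?_⟩
    · rcases Finset.mem_insert.1 hi with rfl | hi' <;> rcases Finset.mem_insert.1 hk with rfl | hk'
      · exact (min_le_left _ _).trans ((hw_diag _).trans_le ha)
      · exact (min_le_left _ _).trans ((hw_symm _ _).trans_le (h.2 k hk' _ hj).2)
      · exact (min_le_left _ _).trans (h.2 i hi' _ hj).2
      · exact h.1 i hi' k hk'
    · rcases Finset.mem_insert.1 hi with rfl | hi
      · exact ⟨hmin k hk, hσ _ hj k hk⟩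
      · exact h.2 i hi k hk

/-- The simplices with the apex contribute minus the count for `w`. Among the others, those inside
the second copy give the count for the minimum, and the rest cancels. -/
theorem signedCount_crossWeights {N : ℕ} {w w' : Fin N → Fin N → ℝ}
    (hw_symm : ∀ i j, w i j = w j i) (hw_diag : ∀ i, w i i = 0) {a : ℝ} (ha : 0 ≤ a) :
    signedCount (crossWeights w w') a
      = signedCount (fun i j => ((min (w i j) (w' i j) : ℝ) : EReal)) a
        - signedCount (fun i j => (w i j : EReal)) a := by
  classical
  have hρ : ∀ (C Q : Prop) [Decidable C] [Decidable Q] (τ : Finset (Fin N)) (x : ℕ), (τ = ∅ → Q) →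
      (∑ ρ : Finset Unit, if C ∧ Q ∧ (τ = ∅ ∨ ρ = ∅) then (-1 : ℝ) ^ (x + (τ.card + ρ.card)) else 0)
        = (if C then (-1 : ℝ) ^ x * (if Q then (-1 : ℝ) ^ τ.card else 0) else 0)
          - if τ = ∅ then (if C then (-1 : ℝ) ^ x else 0) else 0 := by
    intro C Q _ _ τ x hQ
    rw [sum_finset_unit]
    by_cases hτ : τ = ∅
    · have hq := hQ hτ
      subst hτ
      by_cases h1 : C <;> simp [h1, hq, pow_succ]
    · by_cases h1 : C <;> by_cases h2 : Q <;> simp [h1, h2, hτ, pow_add]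
  rw [signedCount, sum_finset_sum]
  simp only [sum_finset_sum, forall_crossWeights_le_iff ha, Finset.card_disjSum]
  rw [Finset.sum_congr rfl fun σ _ => Finset.sum_congr rfl fun τ _ =>
    hρ (∀ i ∈ σ, ∀ j ∈ σ, w i j ≤ a) ((∀ i ∈ τ, ∀ j ∈ τ, min (w i j) (w' i j) ≤ a) ∧
      ∀ i ∈ τ, ∀ j ∈ σ, i ≤ j ∧ w i j ≤ a) τ σ.card (by rintro rfl; simp)]
  simp only [Finset.sum_sub_distrib]
  congr 1
  · rw [signedCount_coe, Finset.sum_eq_single ∅]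
    · simp
    · intro σ _ hσ
      by_cases h : ∀ i ∈ σ, ∀ j ∈ σ, w i j ≤ a
      · simp only [if_pos h]
        rw [← Finset.mul_sum]
        have := sum_signed_crossWeights_fiber (w' := w') hw_symm hw_diag ha
          (Finset.nonempty_iff_ne_empty.2 hσ) h
        convert mul_zero _
      · simp only [if_neg h, Finset.sum_const_zero]
    · simp
  · rw [signedCount_coe]
    refine Finset.sum_congr rfl fun σ _ => ?_
    rw [Finset.sum_ite_eq' Finset.univ ∅ fun _ => _, if_pos (Finset.mem_univ _)]

/-! ### Common thresholds -/

theorem exists_thresholds (S : Finset ℝ) (hS : ∀ r ∈ S, 0 ≤ r) :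
    ∃ (n : ℕ) (t : ℕ → ℝ), StrictMono t ∧ t 0 < 0 ∧ ∀ r ∈ S, ∃ i < n, r = t (i + 1) := by
  -- The extra value `-1` becomes `t 0`, a threshold at which the complexes are empty.
  obtain ⟨n, t, ht, hn⟩ := exists_strictMono_image_range (insert (-1) S)
  have h0 : t 0 < 0 := by
    have : (-1 : ℝ) ∈ (Finset.range n).image t := hn ▸ Finset.mem_insert_self _ _
    obtain ⟨i, -, hi⟩ := Finset.mem_image.1 this
    have := ht.monotone (Nat.zero_le i)
    linarith
  refine ⟨n, t, ht, h0, fun r hr => ?_⟩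
  have : r ∈ (Finset.range n).image t := hn ▸ Finset.mem_insert_of_mem hr
  obtain ⟨i, hi, rfl⟩ := Finset.mem_image.1 this
  obtain _ | i := i
  · exact absurd (hS _ hr) (not_le.2 h0)
  · exact ⟨i, by have := Finset.mem_range.1 hi; omega, rfl⟩

theorem crossWeights_eq_top_or_exists {N : ℕ} (w w' : Fin N → Fin N → ℝ)
    (x y : Fin N ⊕ Fin N ⊕ Unit) :
    crossWeights w w' x y = ⊤ ∨ crossWeights w w' x y = (0 : ℝ) ∨
      ∃ i j, crossWeights w w' x y = w i j ∨
        crossWeights w w' x y = (min (w i j) (w' i j) : ℝ) := by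
  rcases x with i | i | i <;> rcases y with j | j | j
  · exact Or.inr (Or.inr ⟨i, j, Or.inl rfl⟩)
  · by_cases h : j ≤ i
    · exact Or.inr (Or.inr ⟨j, i, Or.inl (if_pos h)⟩)
    · exact Or.inl (if_neg h)
  · exact Or.inr (Or.inl rfl)
  · by_cases h : i ≤ j
    · exact Or.inr (Or.inr ⟨i, j, Or.inl (if_pos h)⟩)
    · exact Or.inl (if_neg h)
  · exact Or.inr (Or.inr ⟨i, j, Or.inr rfl⟩)
  · exact Or.inl rfl
  · exact Or.inr (Or.inl rfl)
  · exact Or.inl rfl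
  · exact Or.inr (Or.inl rfl)

/-- Thresholds that serve the three graphs at once. -/
theorem exists_common_thresholds {N : ℕ} {w w' : Fin N → Fin N → ℝ}
    (hw : ∀ i j, 0 ≤ w i j) (hw' : ∀ i j, 0 ≤ w' i j) :
    ∃ (n : ℕ) (t : ℕ → ℝ), 0 ≤ t n ∧ (∀ i j, w i j ≤ t n) ∧ IsThresholds (crossWeights w w') t n ∧
      IsThresholds (fun i j => (w i j : EReal)) t n ∧
      IsThresholds (fun i j => ((min (w i j) (w' i j) : ℝ) : EReal)) t n := by
  classical
  set S : Finset ℝ := {0} ∪ (Finset.univ.image fun p : Fin N × Fin N => w p.1 p.2) ∪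
    Finset.univ.image fun p : Fin N × Fin N => min (w p.1 p.2) (w' p.1 p.2) with hS
  have hS0 : (0 : ℝ) ∈ S := by simp [hS]
  have hS1 : ∀ i j, w i j ∈ S := fun i j => Finset.mem_union_left _ (Finset.mem_union_right _
    (Finset.mem_image.2 ⟨(i, j), Finset.mem_univ _, rfl⟩))
  have hS2 : ∀ i j, min (w i j) (w' i j) ∈ S := fun i j => Finset.mem_union_right _
    (Finset.mem_image.2 ⟨(i, j), Finset.mem_univ _, rfl⟩)
  have hnonneg : ∀ r ∈ S, 0 ≤ r := by
    intro r hr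
    simp only [hS, Finset.mem_union, Finset.mem_singleton, Finset.mem_image, Finset.mem_univ,
      true_and] at hr
    rcases hr with (rfl | ⟨p, rfl⟩) | ⟨p, rfl⟩
    · exact le_rfl
    · exact hw _ _
    · exact le_min (hw _ _) (hw' _ _)
  obtain ⟨n, t, ht, ht0, hSt⟩ := exists_thresholds S hnonneg
  have hle : ∀ r ∈ S, r ≤ t n := by
    intro r hr
    obtain ⟨i, hi, rfl⟩ := hSt r hr
    exact ht.monotone hi
  have hcoe : ∀ u : Fin N → Fin N → ℝ, (∀ i j, u i j ∈ S) →
      IsThresholds (fun i j => (u i j : EReal)) t n := fun u hu =>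
    ⟨ht, ht0, fun i j => EReal.coe_nonneg.2 (hnonneg _ (hu i j)),
      fun i j r hr => hSt r (EReal.coe_injective hr ▸ hu i j)⟩
  have hcross : ∀ x y, crossWeights w w' x y = ⊤ ∨ ∃ r ∈ S, crossWeights w w' x y = (r : ℝ) := by
    intro x y
    rcases crossWeights_eq_top_or_exists w w' x y with h | h | ⟨i, j, h | h⟩
    · exact Or.inl h
    · exact Or.inr ⟨0, hS0, h⟩
    · exact Or.inr ⟨_, hS1 i j, h⟩
    · exact Or.inr ⟨_, hS2 i j, h⟩
  refine ⟨n, t, hle 0 hS0, fun i j => hle _ (hS1 i j), ⟨ht, ht0, fun x y => ?_, fun x y r hr => ?_⟩,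
    hcoe w hS1, hcoe _ hS2⟩
  · rcases hcross x y with h | ⟨r, hr, h⟩
    · rw [h]; exact le_top
    · rw [h]; exact EReal.coe_nonneg.2 (hnonneg r hr)
  · rcases hcross x y with h | ⟨r', hr', h⟩
    · exact absurd (h.symm.trans hr) (EReal.coe_ne_top r).symm
    · rw [h, EReal.coe_eq_coe_iff] at hr
      exact hSt r (hr ▸ hr')

/-- The identity between the three integrands at a single threshold `a`. -/
theorem dyingEuler_crossWeights_add {N : ℕ} {w w' : Fin N → Fin N → ℝ}
    (hw_symm : ∀ i j, w i j = w j i) (hw_diag : ∀ i, w i i = 0) (hw : ∀ i j, 0 ≤ w i j)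
    (hw' : ∀ i j, 0 ≤ w' i j) {a b : ℝ} (hab : a ≤ b) (hb : 0 ≤ b) (hwb : ∀ i j, w i j ≤ b) :
    dyingEuler (crossWeights w w') a b + dyingEuler (fun i j => (w i j : EReal)) a b
      = dyingEuler (fun i j => ((min (w i j) (w' i j) : ℝ) : EReal)) a b := by
  have hmin : ∀ i j, 0 ≤ min (w i j) (w' i j) := fun i j => le_min (hw i j) (hw' i j)
  have hcross : ∀ x y, 0 ≤ crossWeights w w' x y := by
    intro x y
    rcases crossWeights_eq_top_or_exists w w' x y with h | h | ⟨i, j, h | h⟩ <;> rw [h]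
    · exact le_top
    · exact le_rfl
    · exact EReal.coe_nonneg.2 (hw i j)
    · exact EReal.coe_nonneg.2 (hmin i j)
  rcases lt_or_ge a 0 with ha | ha
  · rw [dyingEuler_of_neg hcross ha, dyingEuler_of_neg (fun i j => EReal.coe_nonneg.2 (hw i j)) ha,
      dyingEuler_of_neg (fun i j => EReal.coe_nonneg.2 (hmin i j)) ha, add_zero]
  · rw [dyingEuler_eq_neg_signedCount hab (isAcyclic_vietorisRips_crossWeights hb hwb)
      (v := .inr (.inr ())) (EReal.coe_nonneg.2 ha), signedCount_crossWeights hw_symm hw_diag ha]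
    obtain _ | N := N
    -- Without vertices the two graphs coincide, and the counts of their (empty) simplices cancel.
    · obtain rfl : w = w' := Subsingleton.elim _ _
      simp only [min_self, sub_self, neg_zero, zero_add]
    · have hdiag : ((w 0 0 : ℝ) : EReal) ≤ a := EReal.coe_le_coe_iff.2 ((hw_diag 0).trans_le ha)
      have hmdiag : ((min (w 0 0) (w' 0 0) : ℝ) : EReal) ≤ a :=
        EReal.coe_le_coe_iff.2 ((min_le_left _ _).trans ((hw_diag 0).trans_le ha))
      rw [dyingEuler_eq_neg_signedCount hab (isAcyclic_vietorisRips_of_forall_le 0 hwb) hdiag,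
        dyingEuler_eq_neg_signedCount hab (isAcyclic_vietorisRips_of_forall_le 0
          fun i j => (min_le_left _ _).trans (hwb i j)) hmdiag]
      ring

end RTD

theorem mainTheorem5 {N : ℕ} (w w' : Fin N → Fin N → ℝ)
    (hw_symm : ∀ i j, w i j = w j i) (hw_diag : ∀ i, w i i = 0) (hw_nonneg : ∀ i j, 0 ≤ w i j)
    (hw'_symm : ∀ i j, w' i j = w' j i) (hw'_diag : ∀ i, w' i i = 0)
    (hw'_nonneg : ∀ i j, 0 ≤ w' i j) :
    ∑ᶠ k : ℕ, (-1 : ℝ) ^ k * RTD.rtd k w w'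
      + ∑ᶠ k : ℕ, (-1 : ℝ) ^ k * RTD.vrLength k w
      - ∑ᶠ k : ℕ, (-1 : ℝ) ^ k * RTD.vrLength k (fun i j => min (w i j) (w' i j)) = 0 := by
  obtain ⟨n, t, htn, hwt, hcross, h, hmin⟩ := RTD.exists_common_thresholds hw_nonneg hw'_nonneg
  simp only [RTD.rtd, RTD.vrLength]
  rw [hcross.finsum_totalBarLength_eq, h.finsum_totalBarLength_eq, hmin.finsum_totalBarLength_eq,
    ← Finset.sum_add_distrib, sub_eq_zero]
  refine Finset.sum_congr rfl fun s hs => ?_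
  have hst : t s ≤ t n := h.strictMono.monotone (Finset.mem_range.1 hs).le
  rw [← mul_add, RTD.dyingEuler_crossWeights_add hw_symm hw_diag hw_nonneg hw'_nonneg hst htn hwt]
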